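/- Let $n\ge 2$, let $\mathcal H$ be a complex Hilbert space, and let $T=(T_1,\dots,T_n)$ be a doubly twisted isometry on $\mathcal H$ with respect to commuting unitaries $\{U_{ij}\}_{1\le i<j\le n}$: every $T_i$ is an isometry, and for all $i<j$ and all $k$, $T_i^*T_j=U_{ij}^*T_jT_i^*$ and $T_kU_{ij}=U_{ij}T_k$. Put $U_{ji}=U_{ij}^*$ for $i<j$. For $A=\{a_1<\dots<a_m\}\subseteq I_n=\{1,\dots,n\}$ and $k\in\mathbb N_0^m$ write $T_A^k=T_{a_1}^{k_1}\cdots T_{a_m}^{k_m}$, and let $\mathcal D_A=\bigcap_{\ell\in\mathbb N_0^{n-m}}T_{I_n\setminus A}^{\ell}\big(\bigcap_{i\in A}\ker T_i^*\big)$, where the intersection over $i\in A$ is $\mathcal H$ if $A=\emptyset$. Let $H^2_{\mathcal D_A}(\mathbb D^{m})$ be the $\mathcal D_A$-valued Hardy space over the polydisc, that is, the functions $f(z)=\sum_{k\in\mathbb N_0^m}z^k\eta_k$ with $\eta_k\in\mathcal D_A$ and $\|f\|^2=\sum_k\|\eta_k\|^2<\infty$ (for $A=\emptyset$ this is $\mathcal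 D_\emptyset$). Let $\Lambda_{A,k}:\mathcal D_A\to T_A^k\mathcal D_A$ be the unitary factor in the polar decomposition of $T_A^k:\mathcal D_A\to T_A^k\mathcal D_A$. Then for every $A\subseteq I_n$ there are bounded operators $M_{A,1},\dots,M_{A,n}$ on $H^2_{\mathcal D_A}(\mathbb D^{|A|})$ such that, for all $k\in\mathbb N_0^{m}$ and $\eta\in\mathcal D_A$, $$M_{A,a_i}(z^k\eta)=z^{k+e_i}\,U_{a_ia_1}^{k_1}\cdots U_{a_ia_{i-1}}^{k_{i-1}}\eta\qquad(1\le i\le m),$$ $$M_{A,q}(z^k\eta)=z^k\,U_{qa_1}^{k_1}\cdots U_{qa_m}^{k_m}T_q\eta\qquad(q\in I_n\setminus A),$$ where the weights map $\mathcal D_A$ into $\mathcal D_A$, and $T$ is unitarily equivalent to $(M_{T,1},\dots,M_{T,n})$ with $M_{T,s}=\bigoplus_{A\subseteq I_n}M_{A,s}$ on $\bigoplus_{A\subseteq I_n}H^2_{\mathcal D_A}(\mathbb D^{|A|})$: there is one unitary $V:\mathcal H\to\bigoplus_{A}H^2_{\mathcal D_A}(\mathbb D^{|A|})$ with $VT_s=M_{T,s}V$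 for all $s$. Moreover $V$ can be chosen so that it maps $\Lambda_{A,k}\eta$ to $z^k\eta$ in the summand of $A$, and the weights above are those of the model defined by the $\Lambda_{A,k}$: $$T_{a_i}\Lambda_{A,k}=\Lambda_{A,k+e_i}U_{a_ia_1}^{k_1}\cdots U_{a_ia_{i-1}}^{k_{i-1}},\qquad T_q\Lambda_{A,k}=\Lambda_{A,k}U_{qa_1}^{k_1}\cdots U_{qa_m}^{k_m}T_q\quad\text{on }\mathcal D_A .$$ -/

import Mathlib

open scoped InnerProductSpace

noncomputable section

/-! ### The vector-valued Hardy space over the polydisc -/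

/-- The monomial `z ^ k = z₁ ^ k₁ ⋯ z_m ^ k_m` at a point of the open unit polydisc. -/
def polydiscMonomial {m : ℕ} (k : Fin m → ℕ) (z : Fin m → Complex.UnitDisc) : ℂ :=
  ∏ i, (z i : ℂ) ^ k i

/-- `f` is the sum on the whole open polydisc of the power series with coefficients `a`. -/
def HasPowerSeries {m : ℕ} {E : Type*} [NormedAddCommGroup E] [InnerProductSpace ℂ E]
    (a : (Fin m → ℕ) → E) (f : (Fin m → Complex.UnitDisc) → E) : Prop :=
  ∀ z, HasSum (fun k => polydiscMonomial k z • a k) (f z)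

theorem powerSeries_coeff_eq_zero_one {g : ℕ → ℂ}
    (h : ∀ t : Complex.UnitDisc, HasSum (fun j => (t : ℂ) ^ j * g j) 0) : g = 0 := by
  let p : FormalMultilinearSeries ℂ ℂ ℂ :=
    fun j => ContinuousMultilinearMap.mkPiRing ℂ (Fin j) (g j)
  have hp : ∀ j, p.coeff j = g j := fun j => by
    simp [p, FormalMultilinearSeries.coeff]
  have h1 : HasFPowerSeriesAt (0 : ℂ → ℂ) p 0 := by
    refine hasFPowerSeriesAt_iff.mpr ?_
    filter_upwards [Metric.ball_mem_nhds (0 : ℂ) one_pos] with t ht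
    have ht' : ‖t‖ < 1 := by simpa using ht
    simpa [hp, smul_eq_mul] using h (Complex.UnitDisc.mk t ht')
  funext j
  rw [← hp j, h1.eq_zero]
  simp [FormalMultilinearSeries.coeff]

theorem powerSeries_slice_eq_zero {K : Type*} {d : ℕ → K → ℂ}
    (h : ∀ t : Complex.UnitDisc,
      HasSum (fun p : ℕ × K => (t : ℂ) ^ p.1 * d p.1 p.2) 0) (j : ℕ) :
    HasSum (d j) 0 := by
  obtain ⟨t, ht⟩ : ∃ t : Complex.UnitDisc, (t : ℂ) ≠ 0 :=
    ⟨Complex.UnitDisc.mk (1 / 2 : ℂ) (by norm_num), by simp⟩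
  have hs : ∀ j, Summable (d j) := by
    intro j
    exact (summable_mul_left_iff (pow_ne_zero j ht)).mp ((h t).summable.prod_factor j)
  have h3 : (fun j => ∑' k, d j k) = 0 :=
    powerSeries_coeff_eq_zero_one fun t =>
      (h t).prod_fiberwise (g := fun j => (t : ℂ) ^ j * ∑' k, d j k) fun j =>
        (hs j).hasSum.mul_left ((t : ℂ) ^ j)
  have h4 := (hs j).hasSum
  rwa [show ∑' k, d j k = 0 from congrFun h3 j] at h4

theorem powerSeries_coeff_eq_zero_scalar {m : ℕ} {c : (Fin m → ℕ) → ℂ}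
    (h : ∀ z, HasSum (fun k => polydiscMonomial k z * c k) 0) : c = 0 := by
  induction m with
  | zero =>
    funext k
    have h1 := (hasSum_unique (fun k => polydiscMonomial k Fin.elim0 * c k)).unique
      (h Fin.elim0)
    rw [Subsingleton.elim k (@default (Fin 0 → ℕ) Unique.instInhabited)]
    change c _ = (0 : ℂ)
    simpa only [polydiscMonomial, Finset.univ_eq_empty, Finset.prod_empty, one_mul] using h1
  | succ m ih =>
    have h2 : ∀ j, (fun k : Fin m → ℕ => c (Fin.cons j k)) = 0 := by
      intro j
      refine ih fun w => ?_
      refine powerSeries_slice_eq_zero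
        (d := fun j k => polydiscMonomial k w * c (Fin.cons j k)) (fun t => ?_) j
      have h1 := (Fin.consEquiv (fun _ : Fin (m + 1) => ℕ)).hasSum_iff.mpr (h (Fin.cons t w))
      convert h1 using 1
      funext p
      simp [polydiscMonomial, Fin.prod_univ_succ, Fin.consEquiv, mul_assoc]
    funext k
    have h6 := congrFun (h2 (k 0)) (Fin.tail k)
    simpa using h6

theorem HasPowerSeries.unique {m : ℕ} {E : Type*} [NormedAddCommGroup E] [InnerProductSpace ℂ E]
    {a b : (Fin m → ℕ) → E} {f : (Fin m → Complex.UnitDisc) → E}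
    (ha : HasPowerSeries a f) (hb : HasPowerSeries b f) : a = b := by
  have h : ∀ v : E, (fun k => ⟪v, a k - b k⟫_ℂ) = 0 := by
    intro v
    apply powerSeries_coeff_eq_zero_scalar
    intro z
    have h1 := ((ha z).sub (hb z)).mapL (innerSL ℂ v)
    simpa [inner_sub_right, inner_smul_right, mul_sub] using h1
  funext k
  have h1 := congrFun (h (a k - b k)) k
  exact sub_eq_zero.mp (inner_self_eq_zero.mp h1)

theorem HasPowerSeries.add {m : ℕ} {E : Type*} [NormedAddCommGroup E] [InnerProductSpace ℂ E]
    {a b : (Fin m → ℕ) → E} {f g : (Fin m → Complex.UnitDisc) → E}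
    (ha : HasPowerSeries a f) (hb : HasPowerSeries b g) :
    HasPowerSeries (a + b) (f + g) := by
  intro z
  simpa [smul_add] using (ha z).add (hb z)

theorem HasPowerSeries.smul {m : ℕ} {E : Type*} [NormedAddCommGroup E] [InnerProductSpace ℂ E]
    {a : (Fin m → ℕ) → E} {f : (Fin m → Complex.UnitDisc) → E} (c : ℂ)
    (ha : HasPowerSeries a f) : HasPowerSeries (c • a) (c • f) := by
  intro z
  simpa only [Pi.smul_apply, smul_comm c] using (ha z).const_smul c

/-- The functions `f(z) = ∑ₖ zᵏ aₖ` on the polydisc `𝔻ᵐ` with values in `E` whose coefficients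
satisfy `∑ₖ ‖aₖ‖² < ∞`. -/
def hardySubmodule (m : ℕ) (E : Type*) [NormedAddCommGroup E] [InnerProductSpace ℂ E] :
    Submodule ℂ ((Fin m → Complex.UnitDisc) → E) where
  carrier := {f | ∃ a : lp (fun _ : Fin m → ℕ => E) 2, HasPowerSeries (fun k => a k) f}
  add_mem' := by
    rintro f g ⟨a, ha⟩ ⟨b, hb⟩
    exact ⟨a + b, ha.add hb⟩
  zero_mem' := ⟨0, fun z => by simp⟩
  smul_mem' := by
    rintro c f ⟨a, ha⟩
    exact ⟨c • a, ha.smul c⟩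

/-- The `E`-valued Hardy space `H²_E(𝔻ᵐ)` over the polydisc. -/
def Hardy (m : ℕ) (E : Type*) [NormedAddCommGroup E] [InnerProductSpace ℂ E] : Type _ :=
  hardySubmodule m E

namespace Hardy

variable {m : ℕ} {E : Type*} [NormedAddCommGroup E] [InnerProductSpace ℂ E]

instance : AddCommGroup (Hardy m E) := inferInstanceAs (AddCommGroup (hardySubmodule m E))

instance : Module ℂ (Hardy m E) := inferInstanceAs (Module ℂ (hardySubmodule m E))

/-- The values of an element of the Hardy space on the polydisc. -/
def toFun (f : Hardy m E) : (Fin m → Complex.UnitDisc) → E := f.1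

/-- The sequence of Taylor coefficients. -/
def coeff (f : Hardy m E) : lp (fun _ : Fin m → ℕ => E) 2 := f.2.choose

theorem hasPowerSeries (f : Hardy m E) : HasPowerSeries (fun k => f.coeff k) f.toFun :=
  f.2.choose_spec

theorem coeff_eq {f : Hardy m E} {a : lp (fun _ : Fin m → ℕ => E) 2}
    (h : HasPowerSeries (fun k => a k) f.toFun) : f.coeff = a :=
  lp.ext (f.hasPowerSeries.unique h)

/-- Taylor coefficients as a linear map. -/
def coeffₗ : Hardy m E →ₗ[ℂ] lp (fun _ : Fin m → ℕ => E) 2 where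
  toFun := coeff
  map_add' f g := coeff_eq (f.hasPowerSeries.add g.hasPowerSeries)
  map_smul' c f := coeff_eq (f.hasPowerSeries.smul c)

theorem coeffₗ_injective : Function.Injective (coeffₗ : Hardy m E →ₗ[ℂ] _) := by
  intro f g h
  have h' : f.coeff = g.coeff := h
  refine Subtype.ext (funext fun z => ?_)
  have h1 := f.hasPowerSeries z
  rw [h'] at h1
  exact h1.unique (g.hasPowerSeries z)

/-- The norm is `‖f‖² = ∑ₖ ‖aₖ‖²`. -/
instance : NormedAddCommGroup (Hardy m E) :=
  NormedAddCommGroup.induced (Hardy m E) (lp (fun _ : Fin m → ℕ => E) 2) coeffₗ coeffₗ_injective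

/-- The inner product is `⟪f, g⟫ = ∑ₖ ⟪aₖ, bₖ⟫`. -/
instance : InnerProductSpace ℂ (Hardy m E) where
  norm_smul_le c f := by
    change ‖coeffₗ (c • f)‖ ≤ ‖c‖ * ‖coeffₗ f‖
    rw [map_smul]
    exact norm_smul_le c _
  inner f g := ⟪coeffₗ f, coeffₗ g⟫_ℂ
  norm_sq_eq_re_inner f := norm_sq_eq_re_inner (𝕜 := ℂ) (coeffₗ f)
  conj_inner_symm f g := inner_conj_symm (𝕜 := ℂ) (coeffₗ f) (coeffₗ g)
  add_left f g h := by simp only [map_add, inner_add_left]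
  smul_left f g c := by simp only [map_smul, inner_smul_left]

/-- The function `z ↦ zᵏ η` (identified with the elementary tensor `zᵏ ⊗ η`). -/
def monomial (k : Fin m → ℕ) (η : E) : Hardy m E :=
  ⟨fun z => polydiscMonomial k z • η, lp.single 2 k η, fun z => by
    have h := hasSum_single (f := fun l => polydiscMonomial l z •
      (lp.single 2 k η : lp (fun _ : Fin m → ℕ => E) 2) l) k (fun l hl => by
        simp [lp.single_apply, Pi.single_eq_of_ne hl])
    simpa [lp.single_apply] using h⟩

end Hardy

/-! ### Doubly twisted isometries -/

variable {n : ℕ} {H : Type*} [NormedAddCommGroup H] [InnerProductSpace ℂ H]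

/-- `T = (T₁, …, Tₙ)` is a doubly twisted isometry with respect to the commuting unitaries
`U i j`, `i < j`. Only the entries of `U` with `i < j` are used. -/
structure IsDoublyTwistedIsometry [CompleteSpace H] (T : Fin n → H →L[ℂ] H)
    (U : Fin n → Fin n → H →L[ℂ] H) : Prop where
  isometry : ∀ i, Isometry (T i)
  unitary : ∀ i j, i < j → U i j ∈ unitary (H →L[ℂ] H)
  commute_unitary : ∀ i j p q, i < j → p < q → Commute (U i j) (U p q)
  commute : ∀ k i j, i < j → Commute (T k) (U i j)
  twist : ∀ i j, i < j → star (T i) * T j = star (U i j) * T j * star (T i)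

/-- The family of unitaries extended to all `i ≠ j` by `U j i = (U i j)*` for `i < j`. -/
def twistExt [CompleteSpace H] (U : Fin n → Fin n → H →L[ℂ] H) (i j : Fin n) : H →L[ℂ] H :=
  if i < j then U i j else star (U j i)

/-- The elements `a₁ < ⋯ < a_m` of `A`, in increasing order. -/
def elt (A : Finset (Fin n)) (i : Fin A.card) : Fin n := A.orderEmbOfFin rfl i

/-- The ordered product `T_A^k = T_{a₁}^{k₁} ⋯ T_{a_m}^{k_m}`. -/
def opPow (T : Fin n → H →L[ℂ] H) (A : Finset (Fin n)) (k : Fin A.card → ℕ) : H →L[ℂ] H :=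
  (List.ofFn fun i => T (elt A i) ^ k i).prod

/-- `W_A`, the intersection of the kernels of `T_i*`, `i ∈ A`; it is `H` for `A = ∅`. -/
def wanderingKer [CompleteSpace H] (T : Fin n → H →L[ℂ] H) (A : Finset (Fin n)) :
    Submodule ℂ H :=
  ⨅ i ∈ A, LinearMap.ker (star (T i) : H →L[ℂ] H).toLinearMap

/-- The `A`-wandering subspace `D_A`, the intersection over all `ℓ` of `T_{Aᶜ}^ℓ W_A`. -/
def wandering [CompleteSpace H] (T : Fin n → H →L[ℂ] H) (A : Finset (Fin n)) :
    Submodule ℂ H :=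
  ⨅ l : Fin (Aᶜ).card → ℕ, (wanderingKer T A).map (opPow T Aᶜ l).toLinearMap

/-- `U_{a_i a_1}^{k_1} ⋯ U_{a_i a_{i-1}}^{k_{i-1}}`. -/
def shiftWeight [CompleteSpace H] (U : Fin n → Fin n → H →L[ℂ] H) (A : Finset (Fin n))
    (i : Fin A.card) (k : Fin A.card → ℕ) : H →L[ℂ] H :=
  (List.ofFn fun j : Fin i =>
    twistExt U (elt A i) (elt A (j.castLE i.isLt.le)) ^ k (j.castLE i.isLt.le)).prod

/-- `U_{q a_1}^{k_1} ⋯ U_{q a_m}^{k_m} T_q`. -/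
def diagWeight [CompleteSpace H] (T : Fin n → H →L[ℂ] H) (U : Fin n → Fin n → H →L[ℂ] H)
    (A : Finset (Fin n)) (q : Fin n) (k : Fin A.card → ℕ) : H →L[ℂ] H :=
  (List.ofFn fun j => twistExt U q (elt A j) ^ k j).prod * T q

/-- `Λ : D → S(D)` is the unitary factor in the polar decomposition `S = Λ P` of the
(injective) operator `S : D → S(D)`, with `P` positive on `D`. -/
def IsPolarUnitary (S : H →L[ℂ] H) (D : Submodule ℂ H)
    (Λ : D ≃ₗᵢ[ℂ] D.map S.toLinearMap) : Prop :=
  ∃ P : D →L[ℂ] D, P.IsPositive ∧ ∀ η : D, (Λ (P η) : H) = S η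

/-- The space `⨁_A H²_{D_A}(𝔻^{|A|})`, a Hilbert space direct sum over all `A ⊆ {1, …, n}`. -/
abbrev ModelSpace [CompleteSpace H] (T : Fin n → H →L[ℂ] H) : Type _ :=
  PiLp 2 fun A : Finset (Fin n) => Hardy A.card (wandering T A)

end

/-! The relation between `T i`* and `T j` forces `T i * T j = twistExt U i j * (T j * T i)`
(`mul_eq`), so reordering a product of the `T s` costs only unitaries that commute with every `T s`.
These unitaries preserve each `wandering T A`, and every `T q` with `q ∉ A` maps it onto itself.
Pushing `T s` through `T_A^k` gives exactly the stated weights (`apply_opPow`,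
`apply_opPow_of_notMem`).

The spaces `T_A^k D_A` are pairwise orthogonal: for `i ∈ A` such a space lies in `T_i^{k_i} ker
T_i*`, for `q ∉ A` it lies in the range of every power of `T_q`, and `T_i^r ker T_i*` is orthogonal
to the range of `T_i^s` when `r < s`.

They are total: their span is reducing, hence so is its orthogonal complement. Inside a nonzero
reducing subspace, treating the indices one at a time yields a nonzero subspace killed by `T_i*` for
`i` in some `A` and on which the other `T_q` are onto (`exists_reducing_subspace`). It lies in
`D_A`, hence in the span, a contradiction (`orthogonal_woldSpan`).

Each `T_A^k` is isometric, so its polar factor is `T_A^k` itself, and `T_A^k η ↦ z^k η` extends to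
the unitary `V`. The model operators are compressions of the `T s`, which makes them bounded. -/

/-! ### Ordered products of powers -/

section OrderedPow

variable {n : ℕ} {H : Type*} [NormedAddCommGroup H] [InnerProductSpace ℂ H]
  {T : Fin n → H →L[ℂ] H} {W : H →L[ℂ] H}

/-- The ordered product `T_{f 0}^{k 0} ⋯ T_{f (m-1)}^{k (m-1)}`. -/
noncomputable def orderedPow {n m : ℕ} {H : Type*} [NormedAddCommGroup H]
    [InnerProductSpace ℂ H] (T : Fin n → H →L[ℂ] H) (f : Fin m → Fin n) (k : Fin m → ℕ) :
    H →L[ℂ] H :=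
  (List.ofFn fun i => T (f i) ^ k i).prod

theorem orderedPow_succ {m : ℕ} (f : Fin (m + 1) → Fin n) (k : Fin (m + 1) → ℕ) :
    orderedPow T f k = T (f 0) ^ k 0 * orderedPow T (Fin.tail f) (Fin.tail k) := by
  simp [orderedPow, List.ofFn_succ, Fin.tail]

/-- Letters with exponent zero do not occur in the product, so `base` excludes them. This is what
allows `T_i*` to be moved past `T_A^k` when `k i = 0`. -/
theorem orderedPow_induction {p : (H →L[ℂ] H) → Prop} (one : p 1)
    (mul : ∀ R S, p R → p S → p (R * S)) {m : ℕ} {f : Fin m → Fin n} {k : Fin m → ℕ}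
    (base : ∀ i, k i ≠ 0 → p (T (f i))) : p (orderedPow T f k) := by
  refine List.prod_induction p mul one ?_
  simp only [List.mem_ofFn, forall_exists_index, forall_apply_eq_imp_iff]
  intro i
  rcases eq_or_ne (k i) 0 with h | h
  · rwa [h, pow_zero]
  · have hp := base i h
    generalize k i = j
    induction j with
    | zero => rwa [pow_zero]
    | succ j ih => rw [pow_succ]; exact mul _ _ ih hp

theorem commute_orderedPow (h : ∀ s, Commute W (T s)) {m : ℕ} (f : Fin m → Fin n)
    (k : Fin m → ℕ) : Commute W (orderedPow T f k) :=
  orderedPow_induction (p := Commute W) (Commute.one_right W) (fun _ _ => Commute.mul_right)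
    fun i _ => h (f i)

theorem orderedPow_apply_mem {K : Submodule ℂ H} {m : ℕ} {f : Fin m → Fin n} {k : Fin m → ℕ}
    (h : ∀ i, k i ≠ 0 → ∀ x ∈ K, T (f i) x ∈ K) {x : H} (hx : x ∈ K) :
    orderedPow T f k x ∈ K :=
  orderedPow_induction (p := fun S => ∀ x ∈ K, S x ∈ K) (fun _ hx => hx)
    (fun _ _ hR hS x hx => hR _ (hS x hx)) h x hx

theorem le_map_orderedPow {K : Submodule ℂ H} {m : ℕ} {f : Fin m → Fin n}
    (h : ∀ i, K ≤ K.map (T (f i)).toLinearMap) (k : Fin m → ℕ) :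
    K ≤ K.map (orderedPow T f k).toLinearMap := by
  refine orderedPow_induction (p := fun S => K ≤ K.map S.toLinearMap) ?_ ?_ fun i _ => h i
  · exact fun x hx => ⟨x, hx, rfl⟩
  · intro R S hR hS x hx
    obtain ⟨y, hy, rfl⟩ := hR hx
    obtain ⟨z, hz, rfl⟩ := hS hy
    exact ⟨z, hz, rfl⟩

theorem norm_orderedPow_apply (h : ∀ i, Isometry (T i)) {m : ℕ} (f : Fin m → Fin n)
    (k : Fin m → ℕ) (x : H) : ‖orderedPow T f k x‖ = ‖x‖ :=
  orderedPow_induction (p := fun S => ∀ x, ‖S x‖ = ‖x‖) (fun _ => rfl)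
    (fun _ S hR hS x => (hR (S x)).trans (hS x))
    (fun i _ x => (AddMonoidHomClass.isometry_iff_norm (T (f i))).1 (h _) x) x

end OrderedPow

/-! ### Twisted commutation relations -/

section DoublyTwisted

variable {n : ℕ} {H : Type*} [NormedAddCommGroup H] [InnerProductSpace ℂ H] [CompleteSpace H]

/-- The unitaries that commute with every `T s`. -/
noncomputable def commutingUnitaries (T : Fin n → H →L[ℂ] H) : Submonoid (H →L[ℂ] H) :=
  unitary (H →L[ℂ] H) ⊓ Submonoid.centralizer (Set.range T)

variable {T : Fin n → H →L[ℂ] H} {U : Fin n → Fin n → H →L[ℂ] H} {W : H →L[ℂ] H}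

theorem mem_commutingUnitaries :
    W ∈ commutingUnitaries T ↔ W ∈ unitary (H →L[ℂ] H) ∧ ∀ s, Commute W (T s) := by
  simp only [commutingUnitaries, Submonoid.mem_inf, Submonoid.mem_centralizer_iff,
    Set.forall_mem_range]
  exact and_congr_right fun _ => forall_congr' fun s => ⟨fun h => h.symm, fun h => h.symm⟩

theorem commute_of_mem_commutingUnitaries (hW : W ∈ commutingUnitaries T) (s : Fin n) :
    Commute W (T s) :=
  (mem_commutingUnitaries.1 hW).2 s

/-- The adjoint of a unitary is its inverse, so it commutes with whatever the unitary commutes with.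
Hence `W` also commutes with the adjoints of the `T s`. -/
theorem star_mem_commutingUnitaries (hW : W ∈ commutingUnitaries T) :
    star W ∈ commutingUnitaries T := by
  rw [mem_commutingUnitaries] at hW ⊢
  refine ⟨Unitary.star_mem hW.1, fun s => ?_⟩
  have h1 := Unitary.star_mul_self_of_mem hW.1
  have h2 := Unitary.mul_star_self_of_mem hW.1
  calc star W * T s = star W * (T s * W) * star W := by simp only [mul_assoc, h2, mul_one]
    _ = (star W * W) * T s * star W := by rw [← (hW.2 s).eq]; simp only [mul_assoc]
    _ = T s * star W := by rw [h1, one_mul]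

theorem commute_star_of_mem_commutingUnitaries (hW : W ∈ commutingUnitaries T) (s : Fin n) :
    Commute W (star (T s)) := by
  have h := (commute_of_mem_commutingUnitaries (star_mem_commutingUnitaries hW) s).star_star
  rwa [star_star] at h

theorem mul_star_apply_of_mem (hW : W ∈ commutingUnitaries T) (x : H) : W (star W x) = x :=
  DFunLike.congr_fun (Unitary.mul_star_self_of_mem (mem_commutingUnitaries.1 hW).1) x

namespace IsDoublyTwistedIsometry

variable (hT : IsDoublyTwistedIsometry T U)

include hT

theorem norm_apply (i : Fin n) (x : H) : ‖T i x‖ = ‖x‖ :=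
  (AddMonoidHomClass.isometry_iff_norm (T i)).1 (hT.isometry i) x

theorem star_mul_self (i : Fin n) : star (T i) * T i = 1 :=
  (ContinuousLinearMap.norm_map_iff_adjoint_comp_self (T i)).1 (hT.norm_apply i)

theorem star_apply_self (i : Fin n) (x : H) : star (T i) (T i x) = x :=
  DFunLike.congr_fun (hT.star_mul_self i) x

theorem mem_commutingUnitaries {i j : Fin n} (h : i < j) : U i j ∈ commutingUnitaries T :=
  _root_.mem_commutingUnitaries.2 ⟨hT.unitary i j h, fun s => (hT.commute s i j h).symm⟩

theorem twistExt_mem {i j : Fin n} (h : i ≠ j) : twistExt U i j ∈ commutingUnitaries T := by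
  rcases h.lt_or_gt with h | h
  · simpa [twistExt, h] using hT.mem_commutingUnitaries h
  · simpa [twistExt, h.not_gt] using star_mem_commutingUnitaries (hT.mem_commutingUnitaries h)

theorem star_mul {i j : Fin n} (h : i ≠ j) :
    star (T i) * T j = star (twistExt U i j) * T j * star (T i) := by
  rcases h.lt_or_gt with h | h
  · simpa [twistExt, h] using hT.twist i j h
  · have h1 := congrArg star (hT.twist j i h)
    simp only [StarMul.star_mul, star_star] at h1
    have hU := hT.mem_commutingUnitaries h
    simp only [twistExt, h.not_gt, if_false, star_star]
    rw [h1, ← mul_assoc, mul_assoc (U j i)]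
    exact ((commute_of_mem_commutingUnitaries hU j).mul_right
      (commute_star_of_mem_commutingUnitaries hU i)).eq.symm

theorem star_apply_apply {i j : Fin n} (h : i ≠ j) (x : H) :
    star (T i) (T j x) = star (twistExt U i j) (T j (star (T i) x)) :=
  DFunLike.congr_fun (hT.star_mul h) x

/-- Equality case of Cauchy–Schwarz: both sides applied to `x` have norm `‖x‖`, and the twist
relation makes their inner product `‖x‖ ^ 2`, so their difference has norm zero. -/
theorem mul_eq {i j : Fin n} (h : i ≠ j) : T i * T j = twistExt U i j * (T j * T i) := by
  have hU := hT.twistExt_mem h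
  set W := twistExt U i j with hW
  ext x
  have h1 : ∀ y : H, ⟪T i (T j y), W (T j (T i y))⟫_ℂ = ⟪y, y⟫_ℂ := by
    intro y
    have h2 : star (T i) (W (T j (T i y))) = T j y := by
      have h3 := DFunLike.congr_fun (commute_star_of_mem_commutingUnitaries hU i).eq (T j (T i y))
      have h4 := hT.star_apply_apply h (T i y)
      rw [← hW, hT.star_apply_self] at h4
      simp only [mul_apply_eq_comp] at h3
      rw [← h3, h4, mul_star_apply_of_mem hU]
    rw [← ContinuousLinearMap.adjoint_inner_right, ← ContinuousLinearMap.star_eq_adjoint, h2,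
      ← ContinuousLinearMap.adjoint_inner_right, ← ContinuousLinearMap.star_eq_adjoint,
      hT.star_apply_self]
  have hn : ∀ y : H, ‖W y‖ = ‖y‖ := fun y =>
    (ContinuousLinearMap.norm_map_iff_adjoint_comp_self W).2
      (Unitary.star_mul_self_of_mem (_root_.mem_commutingUnitaries.1 hU).1) y
  have h5 : ‖T i (T j x) - W (T j (T i x))‖ ^ 2 = 0 := by
    rw [@norm_sub_sq ℂ, h1, hn]
    simp only [hT.norm_apply, inner_self_eq_norm_sq_to_K]
    norm_cast
    ring
  exact sub_eq_zero.1 (norm_eq_zero.1 (pow_eq_zero_iff two_ne_zero |>.1 h5))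

theorem mul_pow_eq {i j : Fin n} (h : i ≠ j) (r : ℕ) :
    T i * T j ^ r = twistExt U i j ^ r * (T j ^ r * T i) := by
  induction r with
  | zero => simp
  | succ r ih =>
    have hc : Commute (twistExt U i j) (T j ^ r) :=
      (commute_of_mem_commutingUnitaries (hT.twistExt_mem h) j).pow_right r
    rw [pow_succ (T j), ← mul_assoc, ih, mul_assoc, mul_assoc, hT.mul_eq h, ← mul_assoc (T j ^ r),
      ← hc.eq, pow_succ]
    simp only [mul_assoc]

/-- Here `q` may be one of the letters `f i`, as happens for `q ∉ A` and the product over `Aᶜ`. An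
unspecified weight is enough for invariance. -/
theorem exists_mul_orderedPow (q : Fin n) {m : ℕ} (f : Fin m → Fin n) (k : Fin m → ℕ) :
    ∃ W ∈ commutingUnitaries T, T q * orderedPow T f k = orderedPow T f k * (W * T q) := by
  refine (orderedPow_induction (T := T) (p := fun R => (∀ W ∈ commutingUnitaries T, Commute W R) ∧
    ∃ W ∈ commutingUnitaries T, T q * R = R * (W * T q)) ?_ ?_ ?_).2
  · exact ⟨fun W _ => Commute.one_right W, 1, one_mem _, by simp⟩
  · rintro R S ⟨hR, V, hV, h⟩ ⟨hS, W, hW, h'⟩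
    refine ⟨fun W hW => (hR W hW).mul_right (hS W hW), V * W, mul_mem hV hW, ?_⟩
    rw [← mul_assoc, h, mul_assoc, mul_assoc, h', ← mul_assoc V, (hS V hV).eq]
    simp only [mul_assoc]
  · refine fun i _ => ⟨fun W hW => commute_of_mem_commutingUnitaries hW _, ?_⟩
    rcases eq_or_ne q (f i) with rfl | hq
    · exact ⟨1, one_mem _, by rw [one_mul]⟩
    · refine ⟨_, hT.twistExt_mem hq, ?_⟩
      rw [hT.mul_eq hq, ← mul_assoc, ← mul_assoc,
        (commute_of_mem_commutingUnitaries (hT.twistExt_mem hq) _).eq]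

theorem prod_twistExt_mem {m : ℕ} {q : Fin n} {f : Fin m → Fin n} (h : ∀ j, q ≠ f j)
    (k : Fin m → ℕ) :
    (List.ofFn fun j => twistExt U q (f j) ^ k j).prod ∈ commutingUnitaries T := by
  refine Submonoid.list_prod_mem _ ?_
  simp only [List.mem_ofFn, forall_exists_index, forall_apply_eq_imp_iff]
  exact fun j => pow_mem (hT.twistExt_mem (h j)) _

theorem mul_orderedPow {m : ℕ} {q : Fin n} {f : Fin m → Fin n} (h : ∀ j, q ≠ f j)
    (k : Fin m → ℕ) :
    T q * orderedPow T f k =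
      orderedPow T f k * ((List.ofFn fun j => twistExt U q (f j) ^ k j).prod * T q) := by
  induction m with
  | zero => simp [orderedPow]
  | succ m ih =>
    have ht : ∀ j, q ≠ Fin.tail f j := fun j => h j.succ
    have hV : twistExt U q (f 0) ^ k 0 ∈ commutingUnitaries T :=
      pow_mem (hT.twistExt_mem (h 0)) _
    have hc := (commute_orderedPow (commute_of_mem_commutingUnitaries hV) f k).eq
    rw [orderedPow_succ] at hc ⊢
    rw [← mul_assoc, hT.mul_pow_eq (h 0), List.ofFn_succ, List.prod_cons, mul_assoc, mul_assoc,
      ih ht (Fin.tail k), ← mul_assoc (T (f 0) ^ k 0), ← mul_assoc, hc]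
    simp only [mul_assoc, Fin.tail]

/-- `T (f i)` only has to pass the factors to the left of its own power, where it is absorbed; hence
the weight runs over `j < i`. -/
theorem mul_orderedPow_of_injective {m : ℕ} {f : Fin m → Fin n} (hf : Function.Injective f)
    (i : Fin m) (k : Fin m → ℕ) :
    T (f i) * orderedPow T f k = orderedPow T f (k + Pi.single i 1) *
      (List.ofFn fun j : Fin i =>
        twistExt U (f i) (f (j.castLE i.isLt.le)) ^ k (j.castLE i.isLt.le)).prod := by
  induction m with
  | zero => exact i.elim0
  | succ m ih =>
    rw [orderedPow_succ, orderedPow_succ]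
    cases i using Fin.cases with
    | zero =>
      have h1 : Fin.tail (k + Pi.single 0 1) = Fin.tail k := by
        funext j; simp [Fin.tail]
      simp [h1, pow_succ', mul_assoc]
    | succ i =>
      have h0 : f i.succ ≠ f 0 := hf.ne (Fin.succ_ne_zero i)
      have h1 : Fin.tail (k + Pi.single i.succ 1) = Fin.tail k + Pi.single i 1 := by
        funext j; simp [Fin.tail, Pi.single_apply]
      have hV : twistExt U (f i.succ) (f 0) ^ k 0 ∈ commutingUnitaries T :=
        pow_mem (hT.twistExt_mem h0) _
      have hc := ((commute_of_mem_commutingUnitaries hV (f 0)).pow_right (k 0)).mul_right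
        (commute_orderedPow (commute_of_mem_commutingUnitaries hV) (Fin.tail f)
          (Fin.tail k + Pi.single i 1))
      have h2 := ih (f := Fin.tail f) (hf.comp (Fin.succ_injective m)) i (Fin.tail k)
      have h3 : (k + Pi.single i.succ 1 : Fin (m + 1) → ℕ) 0 = k 0 := by
        simp
      have h4 : (List.ofFn fun j : Fin (i.succ : ℕ) => twistExt U (f i.succ)
            (f (j.castLE i.succ.isLt.le)) ^ k (j.castLE i.succ.isLt.le)).prod =
          twistExt U (f i.succ) (f 0) ^ k 0 * (List.ofFn fun j : Fin (i : ℕ) =>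
            twistExt U (Fin.tail f i) (Fin.tail f (j.castLE i.isLt.le)) ^
              Fin.tail k (j.castLE i.isLt.le)).prod := by
        exact (congrArg List.prod List.ofFn_succ).trans List.prod_cons
      rw [h1, h3, h4, ← mul_assoc, hT.mul_pow_eq h0, mul_assoc, mul_assoc]
      change _ * (_ * (T (Fin.tail f i) * _)) = _
      rw [h2, ← mul_assoc (T (f 0) ^ k 0), ← mul_assoc, hc.eq]
      simp only [mul_assoc]

end IsDoublyTwistedIsometry
end DoublyTwisted

theorem opPow_zero {n : ℕ} {H : Type*} [NormedAddCommGroup H] [InnerProductSpace ℂ H]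
    (T : Fin n → H →L[ℂ] H) (A : Finset (Fin n)) : opPow T A 0 = 1 := by
  simp [opPow, List.ofFn_const]

/-! ### Wandering subspaces and orthogonality -/

section Wandering

variable {n : ℕ} {H : Type*} [NormedAddCommGroup H] [InnerProductSpace ℂ H] [CompleteSpace H]
  {T : Fin n → H →L[ℂ] H} {U : Fin n → Fin n → H →L[ℂ] H} {W : H →L[ℂ] H}
  {A B : Finset (Fin n)} {x : H}

theorem elt_injective (A : Finset (Fin n)) : Function.Injective (elt A) :=
  (A.orderEmbOfFin rfl).injective

theorem elt_mem (A : Finset (Fin n)) (i : Fin A.card) : elt A i ∈ A :=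
  A.orderEmbOfFin_mem rfl i

theorem exists_elt_eq {q : Fin n} (h : q ∈ A) : ∃ i, elt A i = q := by
  rw [← Finset.mem_coe, ← A.range_orderEmbOfFin rfl] at h
  exact h

theorem ne_elt_of_notMem {q : Fin n} (h : q ∉ A) (j : Fin A.card) : q ≠ elt A j := by
  rintro rfl
  exact h (elt_mem A j)

theorem mem_wanderingKer : x ∈ wanderingKer T A ↔ ∀ i ∈ A, star (T i) x = 0 := by
  simp [wanderingKer, Submodule.mem_iInf]

theorem mem_wandering :
    x ∈ wandering T A ↔ ∀ l, ∃ w ∈ wanderingKer T A, opPow T Aᶜ l w = x := by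
  simp [wandering, Submodule.mem_iInf]

theorem wandering_le_wanderingKer : wandering T A ≤ wanderingKer T A := by
  intro x hx
  obtain ⟨w, hw, rfl⟩ := mem_wandering.1 hx 0
  rwa [opPow_zero]

theorem apply_mem_wanderingKer (hW : W ∈ commutingUnitaries T) (hx : x ∈ wanderingKer T A) :
    W x ∈ wanderingKer T A := by
  rw [mem_wanderingKer] at hx ⊢
  intro i hi
  have h := DFunLike.congr_fun (commute_star_of_mem_commutingUnitaries hW i).eq x
  simp only [mul_apply_eq_comp, hx i hi, map_zero] at h
  exact h.symm

theorem apply_mem_wandering (hW : W ∈ commutingUnitaries T) (hx : x ∈ wandering T A) :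
    W x ∈ wandering T A := by
  rw [mem_wandering] at hx ⊢
  intro l
  obtain ⟨w, hw, rfl⟩ := hx l
  exact ⟨W w, apply_mem_wanderingKer hW hw, (DFunLike.congr_fun (commute_orderedPow
    (commute_of_mem_commutingUnitaries hW) (elt Aᶜ) l).eq w).symm⟩

namespace IsDoublyTwistedIsometry

variable (hT : IsDoublyTwistedIsometry T U)

include hT

theorem star_apply_eq_zero {i j : Fin n} (h : i ≠ j) (hx : star (T i) x = 0) :
    star (T i) (T j x) = 0 := by
  rw [hT.star_apply_apply h, hx, map_zero, map_zero]

theorem star_apply_star_eq_zero {i j : Fin n} (h : i ≠ j) (hx : star (T i) x = 0) :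
    star (T i) (star (T j) x) = 0 := by
  have h1 := congrArg star (hT.mul_eq h.symm)
  simp only [StarMul.star_mul] at h1
  have hU := star_mem_commutingUnitaries (hT.twistExt_mem h.symm)
  have h2 := DFunLike.congr_fun h1 x
  have h3 := DFunLike.congr_fun (commute_star_of_mem_commutingUnitaries hU i).eq x
  simp only [mul_apply_eq_comp] at h2 h3
  rw [h2, ← h3, hx, map_zero, map_zero]

theorem apply_mem_wanderingKer {q : Fin n} (hq : q ∉ A) (hx : x ∈ wanderingKer T A) :
    T q x ∈ wanderingKer T A := by
  rw [mem_wanderingKer] at hx ⊢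
  exact fun i hi => hT.star_apply_eq_zero (fun h => hq (h ▸ hi)) (hx i hi)

theorem shiftWeight_mem (A : Finset (Fin n)) (i : Fin A.card) (k : Fin A.card → ℕ) :
    shiftWeight U A i k ∈ commutingUnitaries T :=
  hT.prod_twistExt_mem (f := fun j : Fin i => elt A (j.castLE i.isLt.le))
    (fun j => (elt_injective A).ne fun h => j.isLt.ne' (congrArg Fin.val h)) _

theorem apply_opPow (A : Finset (Fin n)) (i : Fin A.card) (k : Fin A.card → ℕ) (x : H) :
    T (elt A i) (opPow T A k x) = opPow T A (k + Pi.single i 1) (shiftWeight U A i k x) :=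
  DFunLike.congr_fun (hT.mul_orderedPow_of_injective (elt_injective A) i k) x

theorem apply_opPow_of_notMem {q : Fin n} (hq : q ∉ A) (k : Fin A.card → ℕ) (x : H) :
    T q (opPow T A k x) = opPow T A k (diagWeight T U A q k x) :=
  DFunLike.congr_fun (hT.mul_orderedPow (f := elt A) (ne_elt_of_notMem hq) k) x

theorem opPow_add_single (A : Finset (Fin n)) (i : Fin A.card) (k : Fin A.card → ℕ) (x : H) :
    opPow T A (k + Pi.single i 1) x = T (elt A i) (opPow T A k (star (shiftWeight U A i k) x)) := by
  rw [hT.apply_opPow, mul_star_apply_of_mem (hT.shiftWeight_mem A i k)]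

theorem apply_mem_wandering {q : Fin n} (hq : q ∉ A) (hx : x ∈ wandering T A) :
    T q x ∈ wandering T A := by
  rw [mem_wandering]
  intro l
  obtain ⟨w, hw, rfl⟩ := mem_wandering.1 hx l
  obtain ⟨V, hV, h⟩ := hT.exists_mul_orderedPow q (elt Aᶜ) l
  exact ⟨V (T q w), _root_.apply_mem_wanderingKer hV (hT.apply_mem_wanderingKer hq hw),
    (DFunLike.congr_fun h w).symm⟩

theorem diagWeight_apply_mem {q : Fin n} (hq : q ∉ A) (k : Fin A.card → ℕ)
    (hx : x ∈ wandering T A) : diagWeight T U A q k x ∈ wandering T A := by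
  have hV := hT.prod_twistExt_mem (f := elt A) (ne_elt_of_notMem hq) k
  have h := _root_.apply_mem_wandering hV (hT.apply_mem_wandering hq hx)
  exact h

/-- Since `T q` is injective, the preimage must be `star (T q) x`. It does not depend on `l`, so it
lies in all the subspaces whose intersection is `wandering T A`. -/
theorem exists_apply_eq_of_mem_wandering {q : Fin n} (hq : q ∉ A) (hx : x ∈ wandering T A) :
    ∃ y ∈ wandering T A, T q y = x := by
  obtain ⟨j, rfl⟩ := exists_elt_eq (Finset.mem_compl.2 hq)
  have h : ∀ l, ∃ w ∈ wanderingKer T A, T (elt Aᶜ j) (opPow T Aᶜ l w) = x := by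
    intro l
    -- The extra power of `T q` is pulled out on the left, leaving the exponent `l`.
    obtain ⟨w, hw, rfl⟩ := mem_wandering.1 hx (l + Pi.single j 1)
    exact ⟨_, _root_.apply_mem_wanderingKer
      (star_mem_commutingUnitaries (hT.shiftWeight_mem Aᶜ j l)) hw,
      (hT.opPow_add_single Aᶜ j l w).symm⟩
  have h1 : T (elt Aᶜ j) (star (T (elt Aᶜ j)) x) = x := by
    obtain ⟨w, -, rfl⟩ := h 0
    rw [hT.star_apply_self]
  refine ⟨star (T (elt Aᶜ j)) x, mem_wandering.2 fun l => ?_, h1⟩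
  obtain ⟨w, hw, rfl⟩ := h l
  exact ⟨w, hw, (hT.star_apply_self _ _).symm⟩

theorem opPow_eq_apply_opPow {q : Fin n} (hq : q ∉ A) (k : Fin A.card → ℕ)
    (hx : x ∈ wandering T A) : ∃ y ∈ wandering T A, opPow T A k x = T q (opPow T A k y) := by
  obtain ⟨y, hy, rfl⟩ := hT.exists_apply_eq_of_mem_wandering hq hx
  have hV : (List.ofFn fun j => twistExt U q (elt A j) ^ k j).prod ∈ commutingUnitaries T :=
    hT.prod_twistExt_mem (f := elt A) (ne_elt_of_notMem hq) k
  refine ⟨_, _root_.apply_mem_wandering (star_mem_commutingUnitaries hV) hy, ?_⟩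
  rw [hT.apply_opPow_of_notMem hq]
  congr 1
  have h := DFunLike.congr_fun (commute_of_mem_commutingUnitaries
    (star_mem_commutingUnitaries hV) q).eq y
  simp only [mul_apply_eq_comp] at h
  rw [diagWeight, mul_apply_eq_comp, ← h, mul_star_apply_of_mem hV]

/-- The factor `T q` can be split off again and again because what remains is again in `T_A^k D_A`.
-/
theorem opPow_eq_pow_apply {q : Fin n} (hq : q ∉ A) (k : Fin A.card → ℕ) (r : ℕ)
    (hx : x ∈ wandering T A) : ∃ y, opPow T A k x = (T q ^ r) y := by
  induction r generalizing x with
  | zero => exact ⟨_, rfl⟩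
  | succ r ih =>
    obtain ⟨y, hy, h⟩ := hT.opPow_eq_apply_opPow hq k hx
    obtain ⟨z, hz⟩ := ih hy
    exact ⟨z, by rw [h, hz, pow_succ']; rfl⟩

theorem opPow_add_single_eq_pow_apply (i : Fin A.card) (k : Fin A.card → ℕ) (r : ℕ)
    (hx : x ∈ wandering T A) :
    ∃ y ∈ wandering T A, opPow T A (k + Pi.single i r) x = (T (elt A i) ^ r) (opPow T A k y) := by
  induction r generalizing x with
  | zero => exact ⟨x, hx, by simp⟩
  | succ r ih =>
    obtain ⟨z, hz, h⟩ := ih (_root_.apply_mem_wandering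
      (star_mem_commutingUnitaries (hT.shiftWeight_mem A i (k + Pi.single i r))) hx)
    refine ⟨z, hz, ?_⟩
    rw [Pi.single_add, ← add_assoc, hT.opPow_add_single, h, pow_succ']
    rfl

theorem star_apply_opPow_eq_zero {i : Fin A.card} {k : Fin A.card → ℕ} (hk : k i = 0)
    (hx : x ∈ wandering T A) : star (T (elt A i)) (opPow T A k x) = 0 := by
  refine orderedPow_apply_mem (K := LinearMap.ker (star (T (elt A i)) : H →L[ℂ] H).toLinearMap)
    (fun j hj y hy => hT.star_apply_eq_zero ?_ hy)
    (mem_wanderingKer.1 (wandering_le_wanderingKer hx) _ (elt_mem A i))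
  exact (elt_injective A).ne fun h => hj (h ▸ hk)

theorem opPow_eq_pow_apply_ker (i : Fin A.card) (k : Fin A.card → ℕ) (hx : x ∈ wandering T A) :
    ∃ y, star (T (elt A i)) y = 0 ∧ opPow T A k x = (T (elt A i) ^ k i) y := by
  -- The whole power of `T (elt A i)` is moved to the front; the remaining product does not contain
  -- this letter, so the adjoint still kills its values on `wandering T A`.
  obtain ⟨y, hy, h⟩ := hT.opPow_add_single_eq_pow_apply i (Function.update k i 0) (k i) hx
  refine ⟨_, hT.star_apply_opPow_eq_zero (Function.update_self i 0 k) hy, ?_⟩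
  rw [← h]
  congr 2
  funext j
  rcases eq_or_ne j i with rfl | hj <;> simp [*]

theorem inner_pow_apply_eq_zero {i : Fin n} {r s : ℕ} (hrs : r < s) {y z : H}
    (hy : star (T i) y = 0) : ⟪(T i ^ r) y, (T i ^ s) z⟫_ℂ = 0 := by
  induction r generalizing s with
  | zero =>
    obtain ⟨s, rfl⟩ := Nat.exists_eq_succ_of_ne_zero hrs.ne'
    rw [pow_succ', mul_apply_eq_comp, ← ContinuousLinearMap.adjoint_inner_left,
      ← ContinuousLinearMap.star_eq_adjoint]
    simp [hy]
  | succ r ih =>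
    obtain ⟨s, rfl⟩ := Nat.exists_eq_succ_of_ne_zero (Nat.ne_zero_of_lt hrs)
    rw [pow_succ', pow_succ', mul_apply_eq_comp, mul_apply_eq_comp,
      ← ContinuousLinearMap.adjoint_inner_left, ← ContinuousLinearMap.star_eq_adjoint,
      hT.star_apply_self, ih (Nat.lt_of_succ_lt_succ hrs)]

theorem inner_opPow_eq_zero_of_mem {q : Fin n} (hA : q ∈ A) (hB : q ∉ B) (k : Fin A.card → ℕ)
    (l : Fin B.card → ℕ) {y : H} (hx : x ∈ wandering T A) (hy : y ∈ wandering T B) :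
    ⟪opPow T A k x, opPow T B l y⟫_ℂ = 0 := by
  obtain ⟨i, rfl⟩ := exists_elt_eq hA
  obtain ⟨v, hv, h⟩ := hT.opPow_eq_pow_apply_ker i k hx
  -- Any power above `k i` would do: the first vector lies in `T_q^{k i} ker T_q*`.
  obtain ⟨w, h'⟩ := hT.opPow_eq_pow_apply hB l (k i + 1) hy
  rw [h, h', hT.inner_pow_apply_eq_zero (Nat.lt_succ_self _) hv]

theorem inner_opPow_eq_zero_of_ne (h : A ≠ B) (k : Fin A.card → ℕ)
    (l : Fin B.card → ℕ) {y : H} (hx : x ∈ wandering T A) (hy : y ∈ wandering T B) :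
    ⟪opPow T A k x, opPow T B l y⟫_ℂ = 0 := by
  obtain ⟨q, hq⟩ : ∃ q, ¬(q ∈ A ↔ q ∈ B) := by
    by_contra! hc
    exact h (Finset.ext hc)
  by_cases hA : q ∈ A
  · exact hT.inner_opPow_eq_zero_of_mem hA (fun hB => hq (by simp [hA, hB])) k l hx hy
  · have hB : q ∈ B := by tauto
    exact inner_eq_zero_symm.1 (hT.inner_opPow_eq_zero_of_mem hB hA l k hy hx)

theorem inner_opPow_eq_zero_of_lt {i : Fin A.card} {k l : Fin A.card → ℕ} (h : k i < l i) {y : H}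
    (hx : x ∈ wandering T A) (hy : y ∈ wandering T A) :
    ⟪opPow T A k x, opPow T A l y⟫_ℂ = 0 := by
  obtain ⟨v, hv, h1⟩ := hT.opPow_eq_pow_apply_ker i k hx
  obtain ⟨w, -, h2⟩ := hT.opPow_eq_pow_apply_ker i l hy
  rw [h1, h2, hT.inner_pow_apply_eq_zero h hv]

theorem inner_opPow_eq_zero {k l : Fin A.card → ℕ} (h : k ≠ l) {y : H}
    (hx : x ∈ wandering T A) (hy : y ∈ wandering T A) :
    ⟪opPow T A k x, opPow T A l y⟫_ℂ = 0 := by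
  obtain ⟨i, hi⟩ := Function.ne_iff.1 h
  rcases hi.lt_or_gt with hi | hi
  · exact hT.inner_opPow_eq_zero_of_lt hi hx hy
  · exact inner_eq_zero_symm.1 (hT.inner_opPow_eq_zero_of_lt hi hy hx)

theorem isometry_opPow (A : Finset (Fin n)) (k : Fin A.card → ℕ) : Isometry (opPow T A k) :=
  (AddMonoidHomClass.isometry_iff_norm _).2 (norm_orderedPow_apply hT.isometry _ k)

/-- Isometries of a complete space send closed sets to closed sets. Closedness makes `wandering T A`
complete, as the Hardy space over it requires. -/
theorem isClosed_wandering (A : Finset (Fin n)) : IsClosed (wandering T A : Set H) := by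
  have h : IsClosed (wanderingKer T A : Set H) := by
    simp only [wanderingKer, Submodule.coe_iInf]
    exact isClosed_iInter fun i => isClosed_iInter fun _ => (star (T i)).isClosed_ker
  simp only [wandering, Submodule.coe_iInf]
  refine isClosed_iInter fun l => ?_
  exact (hT.isometry_opPow Aᶜ l).isClosedEmbedding.isClosedMap _ h

end IsDoublyTwistedIsometry
end Wandering

/-! ### Totality of the wandering pieces -/

section Totality

variable {n : ℕ} {H : Type*} [NormedAddCommGroup H] [InnerProductSpace ℂ H] [CompleteSpace H]
  {T : Fin n → H →L[ℂ] H} {U : Fin n → Fin n → H →L[ℂ] H} {A : Finset (Fin n)} {x : H}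

/-- The linear span of all the subspaces `T_A^k D_A`. -/
noncomputable def woldSpan (T : Fin n → H →L[ℂ] H) : Submodule ℂ H :=
  ⨆ (A : Finset (Fin n)) (k : Fin A.card → ℕ), (wandering T A).map (opPow T A k).toLinearMap

theorem opPow_apply_mem_woldSpan (k : Fin A.card → ℕ) (hx : x ∈ wandering T A) :
    opPow T A k x ∈ woldSpan T :=
  Submodule.mem_iSup_of_mem A (Submodule.mem_iSup_of_mem k ⟨x, hx, rfl⟩)

theorem woldSpan_le {K : Submodule ℂ H}
    (h : ∀ A (k : Fin A.card → ℕ), ∀ x ∈ wandering T A, opPow T A k x ∈ K) : woldSpan T ≤ K := by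
  refine iSup_le fun A => iSup_le fun k => ?_
  rintro _ ⟨x, hx, rfl⟩
  exact h A k x hx

/-- A subspace on which every `T i`, `i ∈ A`, has vanishing adjoint and every `T q`, `q ∉ A`, is
onto lies in the wandering subspace of `A`. -/
theorem le_wandering {K : Submodule ℂ H} (hA : ∀ i ∈ A, ∀ x ∈ K, star (T i) x = 0)
    (hA' : ∀ q ∉ A, K ≤ K.map (T q).toLinearMap) : K ≤ wandering T A := by
  intro x hx
  refine mem_wandering.2 fun l => ?_
  obtain ⟨w, hw, h⟩ := le_map_orderedPow (f := elt Aᶜ)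
    (fun i => hA' _ (Finset.mem_compl.1 (elt_mem Aᶜ i))) l hx
  exact ⟨w, mem_wanderingKer.2 fun i hi => hA i hi w hw, h⟩

namespace IsDoublyTwistedIsometry

variable (hT : IsDoublyTwistedIsometry T U)

include hT

theorem apply_mem_woldSpan (s : Fin n) (hx : x ∈ woldSpan T) : T s x ∈ woldSpan T := by
  suffices h : woldSpan T ≤ (woldSpan T).comap (T s).toLinearMap from h hx
  refine woldSpan_le fun A k x hx => ?_
  change T s (opPow T A k x) ∈ woldSpan T
  by_cases hs : s ∈ A
  · obtain ⟨i, rfl⟩ := exists_elt_eq hs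
    rw [hT.apply_opPow]
    exact opPow_apply_mem_woldSpan _ (_root_.apply_mem_wandering (hT.shiftWeight_mem A i k) hx)
  · rw [hT.apply_opPow_of_notMem hs]
    exact opPow_apply_mem_woldSpan _ (hT.diagWeight_apply_mem hs k hx)

/-- On `T_A^k D_A` the adjoint gives zero if `s ∈ A` has exponent zero, lowers that exponent by one
if it is positive, and strips a factor `T s` if `s ∉ A`. -/
theorem star_apply_mem_woldSpan (s : Fin n) (hx : x ∈ woldSpan T) :
    star (T s) x ∈ woldSpan T := by
  suffices h : woldSpan T ≤ (woldSpan T).comap (star (T s) : H →L[ℂ] H).toLinearMap from h hx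
  refine woldSpan_le fun A k x hx => ?_
  change star (T s) (opPow T A k x) ∈ woldSpan T
  by_cases hs : s ∈ A
  · obtain ⟨i, rfl⟩ := exists_elt_eq hs
    rcases Nat.eq_zero_or_eq_succ_pred (k i) with hk | hk
    · rw [hT.star_apply_opPow_eq_zero hk hx]
      exact zero_mem _
    · have h : k = Function.update k i (k i).pred + Pi.single i 1 := by
        funext j
        rcases eq_or_ne j i with rfl | hj
        · simpa using hk
        · simp [hj]
      rw [h, hT.opPow_add_single, hT.star_apply_self]
      exact opPow_apply_mem_woldSpan _
        (_root_.apply_mem_wandering (star_mem_commutingUnitaries (hT.shiftWeight_mem A i _)) hx)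
  · obtain ⟨y, hy, h⟩ := hT.opPow_eq_apply_opPow hs k hx
    rw [h, hT.star_apply_self]
    exact opPow_apply_mem_woldSpan _ hy

/-- A nonzero reducing subspace contains a nonzero subspace which reduces `T s` for `s ∉ A`, is
killed by `(T i)*` for `i ∈ A`, and on which `T i` is unitary for `i ∈ S \ A`. -/
theorem exists_reducing_subspace {K : Submodule ℂ H} (hK : K ≠ ⊥)
    (hKT : ∀ s, ∀ x ∈ K, T s x ∈ K ∧ star (T s) x ∈ K) (S : Finset (Fin n)) :
    ∃ A : Finset (Fin n), ∃ L ≤ K, L ≠ ⊥ ∧ (∀ s ∉ A, ∀ x ∈ L, T s x ∈ L ∧ star (T s) x ∈ L) ∧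
      (∀ i ∈ A, ∀ x ∈ L, star (T i) x = 0) ∧
      ∀ i ∈ S, i ∉ A → ∀ x ∈ L, T i (star (T i) x) = x := by
  induction S using Finset.induction_on with
  | empty => exact ⟨∅, K, le_rfl, hK, fun s _ => hKT s, by simp, by simp⟩
  | insert a S _ ih =>
    obtain ⟨A, L, hLK, hL, hLT, hLA, hLS⟩ := ih
    by_cases haA : a ∈ A
    · refine ⟨A, L, hLK, hL, hLT, hLA, fun i hi hiA => ?_⟩
      rcases Finset.mem_insert.1 hi with rfl | hi
      · exact absurd haA hiA
      · exact hLS i hi hiA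
    -- If the intersection is zero, `x - T a (star (T a) x)` vanishes on `L` and `a` stays outside
    -- `A`. Otherwise the intersection replaces `L` and `a` joins `A`; the remaining `T s` still
    -- reduce it, since they and their adjoints preserve the kernel of `star (T a)`.
    by_cases hbot : L ⊓ LinearMap.ker (star (T a) : H →L[ℂ] H).toLinearMap = ⊥
    · refine ⟨A, L, hLK, hL, hLT, hLA, fun i hi hiA x hx => ?_⟩
      rcases Finset.mem_insert.1 hi with rfl | hi
      · have h : x - T i (star (T i) x) ∈
            L ⊓ LinearMap.ker (star (T i) : H →L[ℂ] H).toLinearMap := by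
          refine ⟨L.sub_mem hx (hLT i hiA _ (hLT i hiA x hx).2).1, ?_⟩
          change star (T i) (x - T i (star (T i) x)) = 0
          rw [map_sub, hT.star_apply_self, sub_self]
        rw [hbot] at h
        exact (sub_eq_zero.1 ((Submodule.mem_bot ℂ).1 h)).symm
      · exact hLS i hi hiA x hx
    · refine ⟨insert a A, _, inf_le_left.trans hLK, hbot, fun s hs x hx => ?_, fun i hi x hx => ?_,
        fun i hi hiA x hx => ?_⟩
      · obtain ⟨hsa, hsA⟩ := not_or.1 (mt Finset.mem_insert.2 hs)
        exact ⟨⟨(hLT s hsA x hx.1).1, hT.star_apply_eq_zero (Ne.symm hsa) hx.2⟩,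
          ⟨(hLT s hsA x hx.1).2, hT.star_apply_star_eq_zero (Ne.symm hsa) hx.2⟩⟩
      · rcases Finset.mem_insert.1 hi with rfl | hi
        · exact hx.2
        · exact hLA i hi x hx.1
      · obtain ⟨hia, hiA⟩ := not_or.1 (mt Finset.mem_insert.2 hiA)
        exact hLS i ((Finset.mem_insert.1 hi).resolve_left hia) hiA x hx.1

theorem orthogonal_woldSpan : (woldSpan T)ᗮ = ⊥ := by
  by_contra hK
  have hKT : ∀ s, ∀ x ∈ (woldSpan T)ᗮ, T s x ∈ (woldSpan T)ᗮ ∧ star (T s) x ∈ (woldSpan T)ᗮ := by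
    refine fun s x hx => ⟨fun y hy => ?_, fun y hy => ?_⟩
    · rw [← ContinuousLinearMap.adjoint_inner_left, ← ContinuousLinearMap.star_eq_adjoint]
      exact hx _ (hT.star_apply_mem_woldSpan s hy)
    · rw [ContinuousLinearMap.star_eq_adjoint, ContinuousLinearMap.adjoint_inner_right]
      exact hx _ (hT.apply_mem_woldSpan s hy)
  obtain ⟨A, L, hLK, hL, hLT, hLA, hLS⟩ := hT.exists_reducing_subspace hK hKT Finset.univ
  have hLD : L ≤ wandering T A := le_wandering hLA fun q hq x hx =>
    ⟨_, (hLT q hq x hx).2, hLS q (Finset.mem_univ q) hq x hx⟩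
  refine hL ((Submodule.eq_bot_iff L).2 fun x hx => ?_)
  -- With exponent zero, `x` itself lies in the span, and it is also orthogonal to the span.
  have h := opPow_apply_mem_woldSpan 0 (hLD hx)
  rw [opPow_zero] at h
  exact inner_self_eq_zero.1 (hLK hx x h)

end IsDoublyTwistedIsometry
end Totality

/-! ### Completeness of the Hardy space -/

section HardyComplete

/-- A product of convergent geometric series, one for each variable. -/
theorem summable_norm_polydiscMonomial {m : ℕ} (z : Fin m → Complex.UnitDisc) :
    Summable fun k => ‖polydiscMonomial k z‖ := by
  induction m with
  | zero => exact (hasSum_unique _).summable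
  | succ m ih =>
    rw [← (Fin.consEquiv fun _ : Fin (m + 1) => ℕ).summable_iff]
    have h0 : Summable fun j : ℕ => ‖(z 0 : ℂ)‖ ^ j :=
      summable_geometric_of_lt_one (norm_nonneg _) (z 0).norm_lt_one
    convert h0.mul_of_nonneg (ih (Fin.tail z)) (fun _ => pow_nonneg (norm_nonneg _) _)
      (fun _ => norm_nonneg _) using 1
    funext p
    simp [polydiscMonomial, Fin.prod_univ_succ, Fin.consEquiv, Fin.tail]

namespace Hardy

variable {m : ℕ} {E : Type*} [NormedAddCommGroup E] [InnerProductSpace ℂ E]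

theorem coeff_monomial (k : Fin m → ℕ) (η : E) : (monomial k η).coeff = lp.single 2 k η :=
  coeff_eq fun z => by
    have h := hasSum_single (f := fun l => polydiscMonomial l z •
      (lp.single 2 k η : lp (fun _ : Fin m → ℕ => E) 2) l) k (fun l hl => by
        simp [lp.single_apply, Pi.single_eq_of_ne hl])
    change HasSum _ (polydiscMonomial k z • η)
    simpa [lp.single_apply] using h

variable [CompleteSpace E]

/-- Square-summable coefficients are bounded, so the power series converges absolutely at every
point of the polydisc; completeness of `E` then gives its sum. -/
theorem coeffₗ_surjective : Function.Surjective (coeffₗ : Hardy m E →ₗ[ℂ] _) := by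
  intro a
  have ha : ∀ z, Summable fun k => polydiscMonomial k z • a k := fun z => by
    refine ((summable_norm_polydiscMonomial z).mul_right ‖a‖).of_norm_bounded fun k => ?_
    rw [norm_smul]
    exact mul_le_mul_of_nonneg_left (lp.norm_apply_le_norm two_ne_zero a k) (norm_nonneg _)
  have h : HasPowerSeries (fun k => a k) fun z => ∑' k, polydiscMonomial k z • a k :=
    fun z => (ha z).hasSum
  exact ⟨⟨_, a, h⟩, coeff_eq h⟩

/-- Taylor coefficients as a unitary map onto `ℓ²`. -/
noncomputable def coeffEquiv : Hardy m E ≃ₗᵢ[ℂ] lp (fun _ : Fin m → ℕ => E) 2 where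
  toLinearEquiv := LinearEquiv.ofBijective coeffₗ ⟨coeffₗ_injective, coeffₗ_surjective⟩
  norm_map' _ := rfl

theorem coeffEquiv_monomial (k : Fin m → ℕ) (η : E) :
    coeffEquiv (monomial k η) = lp.single 2 k η :=
  coeff_monomial k η

instance : CompleteSpace (Hardy m E) :=
  (coeffEquiv (m := m) (E := E)).toIsometryEquiv.completeSpace_iff.2 inferInstance

end Hardy
end HardyComplete

/-! ### The model and the unitary equivalence -/

section Model

variable {n : ℕ} {H : Type*} [NormedAddCommGroup H] [InnerProductSpace ℂ H] [CompleteSpace H]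
  {T : Fin n → H →L[ℂ] H} {U : Fin n → Fin n → H →L[ℂ] H}

theorem inner_eq_zero_of_hasSum {ι E : Type*} [NormedAddCommGroup E] [InnerProductSpace ℂ E]
    {f : ι → E} {x v : E} (hf : HasSum f x) (h : ∀ i, ⟪v, f i⟫_ℂ = 0) : ⟪v, x⟫_ℂ = 0 := by
  have h1 := hf.mapL (innerSL ℂ v)
  simp only [innerSL_apply_apply, h] at h1
  exact h1.unique hasSum_zero

namespace IsDoublyTwistedIsometry

variable (hT : IsDoublyTwistedIsometry T U)

include hT

/-- `T_A^k` as an isometry of `D_A` into the whole space. -/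
noncomputable def wanderingIsometry (A : Finset (Fin n))
    (k : Fin A.card → ℕ) : wandering T A →ₗᵢ[ℂ] H where
  toLinearMap := (opPow T A k).toLinearMap ∘ₗ (wandering T A).subtype
  norm_map' η := norm_orderedPow_apply hT.isometry (elt A) k η

/-- `T_A^k` as a unitary map of `D_A` onto `T_A^k D_A`. -/
noncomputable def wanderingEquiv (A : Finset (Fin n))
    (k : Fin A.card → ℕ) :
    wandering T A ≃ₗᵢ[ℂ] (wandering T A).map (opPow T A k).toLinearMap where
  toLinearEquiv := Submodule.equivMapOfInjective _ (hT.isometry_opPow A k).injective _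
  norm_map' η := norm_orderedPow_apply hT.isometry (elt A) k η

theorem isPolarUnitary_wanderingEquiv (A : Finset (Fin n)) (k : Fin A.card → ℕ) :
    IsPolarUnitary (opPow T A k) (wandering T A) (hT.wanderingEquiv A k) :=
  -- The operator is isometric, so its positive factor is the identity.
  ⟨1, ContinuousLinearMap.isPositive_one, fun _ => rfl⟩

theorem orthogonalFamily (A : Finset (Fin n)) :
    OrthogonalFamily ℂ (fun _ : Fin A.card → ℕ => wandering T A) (hT.wanderingIsometry A) :=
  fun _ _ h η ξ => hT.inner_opPow_eq_zero h η.2 ξ.2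

theorem completeSpace_wandering (A : Finset (Fin n)) : CompleteSpace (wandering T A) :=
  (hT.isClosed_wandering A).completeSpace_coe

/-- The isometry of `H²_{D_A}` into `H` that maps `z ^ k η` to `T_A^k η`. -/
noncomputable def hardyIsometry (A : Finset (Fin n)) :
    Hardy A.card (wandering T A) →ₗᵢ[ℂ] H :=
  have := hT.completeSpace_wandering A
  (hT.orthogonalFamily A).linearIsometry.comp Hardy.coeffEquiv.toLinearIsometry

theorem hardyIsometry_monomial (A : Finset (Fin n)) (k : Fin A.card → ℕ) (η : wandering T A) :
    hT.hardyIsometry A (Hardy.monomial k η) = opPow T A k η := by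
  have := hT.completeSpace_wandering A
  change (hT.orthogonalFamily A).linearIsometry (Hardy.coeffEquiv (Hardy.monomial k η)) = _
  rw [Hardy.coeffEquiv_monomial, OrthogonalFamily.linearIsometry_apply_single]
  rfl

theorem hasSum_hardyIsometry (A : Finset (Fin n)) (f : Hardy A.card (wandering T A)) :
    HasSum (fun k => opPow T A k (f.coeff k)) (hT.hardyIsometry A f) :=
  (hT.orthogonalFamily A).hasSum_linearIsometry f.coeff

theorem orthogonalFamily_hardyIsometry :
    OrthogonalFamily ℂ (fun A : Finset (Fin n) => Hardy A.card (wandering T A))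
      hT.hardyIsometry := by
  intro A B h f g
  refine inner_eq_zero_of_hasSum (hT.hasSum_hardyIsometry B g) fun l => ?_
  refine inner_eq_zero_symm.1 (inner_eq_zero_of_hasSum (hT.hasSum_hardyIsometry A f) fun k => ?_)
  exact hT.inner_opPow_eq_zero_of_ne h.symm l k (g.coeff l).2 (f.coeff k).2

theorem topologicalClosure_woldSpan : (woldSpan T).topologicalClosure = ⊤ :=
  (woldSpan T).topologicalClosure_eq_top_iff.2 hT.orthogonal_woldSpan

theorem isHilbertSum_hardyIsometry :
    IsHilbertSum ℂ (fun A : Finset (Fin n) => Hardy A.card (wandering T A)) hT.hardyIsometry := by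
  have := hT.completeSpace_wandering
  refine IsHilbertSum.mk hT.orthogonalFamily_hardyIsometry ?_
  rw [← hT.topologicalClosure_woldSpan]
  refine Submodule.topologicalClosure_mono (woldSpan_le fun A k η hη => ?_)
  exact Submodule.mem_iSup_of_mem A
    ⟨Hardy.monomial k ⟨η, hη⟩, hT.hardyIsometry_monomial A k ⟨η, hη⟩⟩

/-- The unitary map onto the model space. -/
noncomputable def modelEquiv : H ≃ₗᵢ[ℂ] ModelSpace T :=
  hT.isHilbertSum_hardyIsometry.linearIsometryEquiv.trans (lpPiLpₗᵢ _ ℂ)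

theorem modelEquiv_hardyIsometry (A : Finset (Fin n)) (f : Hardy A.card (wandering T A)) :
    hT.modelEquiv (hT.hardyIsometry A f) = PiLp.single 2 A f := by
  have h : hT.isHilbertSum_hardyIsometry.linearIsometryEquiv (hT.hardyIsometry A f) =
      lp.single 2 A f := by
    rw [← hT.isHilbertSum_hardyIsometry.linearIsometryEquiv_symm_apply_single,
      LinearIsometryEquiv.apply_symm_apply]
  change lpPiLpₗᵢ _ ℂ (hT.isHilbertSum_hardyIsometry.linearIsometryEquiv _) = _
  rw [h]
  ext B : 1
  rw [coe_lpPiLpₗᵢ, lp.single_apply]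
  rfl

theorem modelEquiv_opPow (A : Finset (Fin n)) (k : Fin A.card → ℕ) (η : wandering T A) :
    hT.modelEquiv (opPow T A k η) = PiLp.single 2 A (Hardy.monomial k η) := by
  rw [← hT.hardyIsometry_monomial, hT.modelEquiv_hardyIsometry]

/-- The compression of `T s` to the summand of `A`. -/
noncomputable def modelOperator (A : Finset (Fin n))
    (s : Fin n) : Hardy A.card (wandering T A) →L[ℂ] Hardy A.card (wandering T A) :=
  PiLp.proj 2 _ A ∘L hT.modelEquiv.toContinuousLinearEquiv.toContinuousLinearMap ∘L T s ∘L
    (hT.hardyIsometry A).toContinuousLinearMap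

theorem modelOperator_apply (A : Finset (Fin n)) (s : Fin n)
    (f : Hardy A.card (wandering T A)) :
    hT.modelOperator A s f = hT.modelEquiv (T s (hT.hardyIsometry A f)) A :=
  rfl

theorem modelOperator_monomial {A : Finset (Fin n)} {s : Fin n} {k l : Fin A.card → ℕ}
    {η ξ : wandering T A} (h : T s (opPow T A k η) = opPow T A l ξ) :
    hT.modelOperator A s (Hardy.monomial k η) = Hardy.monomial l ξ := by
  rw [hT.modelOperator_apply, hT.hardyIsometry_monomial, h, hT.modelEquiv_opPow,
    PiLp.single_eq_same]

theorem exists_apply_opPow_eq (s : Fin n) (A : Finset (Fin n)) (k : Fin A.card → ℕ)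
    (η : wandering T A) : ∃ l, ∃ ξ : wandering T A, T s (opPow T A k η) = opPow T A l ξ := by
  by_cases hs : s ∈ A
  · obtain ⟨i, rfl⟩ := exists_elt_eq hs
    exact ⟨_, ⟨_, _root_.apply_mem_wandering (hT.shiftWeight_mem A i k) η.2⟩,
      hT.apply_opPow A i k η⟩
  · exact ⟨_, ⟨_, hT.diagWeight_apply_mem hs k η.2⟩, hT.apply_opPow_of_notMem hs k η⟩

/-- Both sides are continuous and linear in `x`, so it is enough to compare them on the vectors
`T_B^k η`, whose span is dense. There `T s` stays in the summand of `B`, so the component at `A ≠ B`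
vanishes on both sides. -/
theorem modelEquiv_apply (s : Fin n) (x : H) (A : Finset (Fin n)) :
    hT.modelEquiv (T s x) A = hT.modelOperator A s (hT.modelEquiv x A) := by
  let P : H →L[ℂ] Hardy A.card (wandering T A) :=
    PiLp.proj 2 _ A ∘L hT.modelEquiv.toContinuousLinearEquiv.toContinuousLinearMap
  suffices h : (⊤ : Submodule ℂ H) ≤
      LinearMap.eqLocus (P ∘L T s).toLinearMap (hT.modelOperator A s ∘L P).toLinearMap from
    h (Submodule.mem_top (x := x))
  rw [← hT.topologicalClosure_woldSpan]
  refine Submodule.topologicalClosure_minimal _ (woldSpan_le fun B k η hη => ?_)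
    (isClosed_eq (P ∘L T s).continuous (hT.modelOperator A s ∘L P).continuous)
  obtain ⟨l, ξ, h⟩ := hT.exists_apply_opPow_eq s B k ⟨η, hη⟩
  change hT.modelEquiv (T s (opPow T B k η)) A =
    hT.modelOperator A s (hT.modelEquiv (opPow T B k η) A)
  have h1 := hT.modelEquiv_opPow B k ⟨η, hη⟩
  simp only at h h1
  rw [h, h1, hT.modelEquiv_opPow]
  rcases eq_or_ne A B with rfl | hAB
  · rw [PiLp.single_eq_same, PiLp.single_eq_same, hT.modelOperator_monomial h]
  · rw [PiLp.single_eq_of_ne _ hAB, PiLp.single_eq_of_ne _ hAB, map_zero]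

end IsDoublyTwistedIsometry
end Model

theorem mainTheorem8 {n : ℕ} (hn : 2 ≤ n) {H : Type*} [NormedAddCommGroup H]
    [InnerProductSpace ℂ H] [CompleteSpace H] (T : Fin n → H →L[ℂ] H)
    (U : Fin n → Fin n → H →L[ℂ] H) (hT : IsDoublyTwistedIsometry T U) :
    -- the weights map each wandering subspace into itself
    ∃ (hshift : ∀ (A : Finset (Fin n)) (i : Fin A.card) (k : Fin A.card → ℕ),
          ∀ η ∈ wandering T A, shiftWeight U A i k η ∈ wandering T A)
      (hdiag : ∀ (A : Finset (Fin n)) (q : Fin n), q ∉ A → ∀ k : Fin A.card → ℕ,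
          ∀ η ∈ wandering T A, diagWeight T U A q k η ∈ wandering T A)
      (Λ : ∀ (A : Finset (Fin n)) (k : Fin A.card → ℕ),
          wandering T A ≃ₗᵢ[ℂ] (wandering T A).map (opPow T A k).toLinearMap)
      (M : ∀ A : Finset (Fin n), Fin n →
          (Hardy A.card (wandering T A) →L[ℂ] Hardy A.card (wandering T A)))
      (V : H ≃ₗᵢ[ℂ] ModelSpace T),
      -- the unitaries coming from the polar decompositions, and the weights they define
      (∀ A k, IsPolarUnitary (opPow T A k) (wandering T A) (Λ A k)) ∧
      (∀ A i k (η : wandering T A), T (elt A i) (Λ A k η) =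
        Λ A (k + Pi.single i 1) ⟨shiftWeight U A i k η, hshift A i k η η.2⟩) ∧
      (∀ A q (hq : q ∉ A) k (η : wandering T A), T q (Λ A k η) =
        Λ A k ⟨diagWeight T U A q k η, hdiag A q hq k η η.2⟩) ∧
      -- the model operators on monomials
      (∀ A i k (η : wandering T A), M A (elt A i) (Hardy.monomial k η) =
        Hardy.monomial (k + Pi.single i 1) ⟨shiftWeight U A i k η, hshift A i k η η.2⟩) ∧
      (∀ A q (hq : q ∉ A) k (η : wandering T A), M A q (Hardy.monomial k η) =
        Hardy.monomial k ⟨diagWeight T U A q k η, hdiag A q hq k η η.2⟩) ∧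
      -- the unitary equivalence of `T` with the direct sums of the model operators
      (∀ A k (η : wandering T A),
        V (Λ A k η) = PiLp.single 2 A (Hardy.monomial k η)) ∧
      ∀ s x A, V (T s x) A = M A s (V x A) := by
  have hshift : ∀ (A : Finset (Fin n)) (i : Fin A.card) (k : Fin A.card → ℕ),
      ∀ η ∈ wandering T A, shiftWeight U A i k η ∈ wandering T A :=
    fun A i k _ hη => apply_mem_wandering (hT.shiftWeight_mem A i k) hη
  have hdiag : ∀ (A : Finset (Fin n)) (q : Fin n), q ∉ A → ∀ k : Fin A.card → ℕ,
      ∀ η ∈ wandering T A, diagWeight T U A q k η ∈ wandering T A :=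
    fun A q hq k _ hη => hT.diagWeight_apply_mem hq k hη
  -- As `Λ A k η` is by definition `opPow T A k η`, the identities for `Λ` are those already proved
  -- for the ordered products.
  exact ⟨hshift, hdiag, hT.wanderingEquiv, hT.modelOperator, hT.modelEquiv,
    hT.isPolarUnitary_wanderingEquiv,
    fun A i k η => hT.apply_opPow A i k η,
    fun A q hq k η => hT.apply_opPow_of_notMem hq k η,
    fun A i k η => hT.modelOperator_monomial (hT.apply_opPow A i k η),
    fun A q hq k η => hT.modelOperator_monomial (hT.apply_opPow_of_notMem hq k η),
    hT.modelEquiv_opPow, hT.modelEquiv_apply⟩
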